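/- Let $G$ be a finite group and let $T$ be a $G$-Tambara functor, given levelwise by commutative rings $T(G/H)$ for $H\le G$, with restrictions $r^H_K$, transfers $t^H_K$ and norms $N^H_K$ for $K\le H$, and conjugations $c_{g,H}\colon T(G/H)\to T(G/gHg^{-1})$. A Tambara ideal $I\trianglelefteq T$ is a family of ideals $I(G/H)\subseteq T(G/H)$, one for each $H\le G$, closed under restrictions, transfers and norms, and with $c_{g,H}(I(G/H))=I(G/gHg^{-1})$ for all $g\in G$ and $H\le G$. Tambara ideals are ordered by levelwise inclusion. The product $IJ$ is the smallest Tambara ideal containing all the ideals $I(G/H)\cdot J(G/H)$. For $x\in T(G/H)$, $\langle x\rangle$ denotes the smallest Tambara ideal containing $x$ at level $G/H$. The radical $\sqrt I$ has levels $$(\sqrt I)(G/H)=\{x\in T(G/H)\mid \langle x\rangle^n\subseteq I\text{ for some } n\ge 1\},$$ and $I$ is radical if $I=\sqrt I$. Let $\mathrm{RadId}_G(T)$ be the set of radical Tambara ideals of $T$, ordered by inclusion. Proposition. $\mathrm{RadId}_G(T)$ is a frame, i.e. a complete lattice in which finite meets distribute over arbitrary joins. Meets are levelwise intersections, $(\bigwedge_\lambda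 I_\lambda)(G/H)=\bigcap_\lambda I_\lambda(G/H)$. For every family $(I_\lambda)_\lambda$ of radical Tambara ideals, the levelwise sum $(\sum_\lambda I_\lambda)(G/H)=\sum_\lambda I_\lambda(G/H)$ is a Tambara ideal, and the join is its radical: $$\bigvee_\lambda I_\lambda=\sqrt{\textstyle\sum_\lambda I_\lambda}.$$ Moreover, at each level the join is the ordinary radical of the sum in the ring $T(G/H)$, $(\bigvee_\lambda I_\lambda)(G/H)=\sqrt{\sum_\lambda I_\lambda(G/H)}$, so that at the level $G/H$ the distributivity law $K\wedge\bigvee_\lambda I_\lambda=\bigvee_\lambda (K\wedge I_\lambda)$ is the identity of ideals of the ring $T(G/H)$ $$K(G/H)\cap\sqrt{\textstyle\sum_\lambda I_\lambda(G/H)}=\sqrt{\textstyle\sum_\lambda\bigl(K(G/H)\cap I_\lambda(G/H)\bigr)}.$$ -/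

import Mathlib

universe u v w

/-- The conjugate subgroup `g H g⁻¹`. -/
def conjSubgroup {G : Type u} [Group G] (g : G) (H : Subgroup G) : Subgroup G :=
  H.map (MulAut.conj g).toMonoidHom

namespace TambaraReciprocity

variable {G : Type u} [Group G]

/-- Functions `H/K → {a, b}` (with `true` standing for `a` and `false` for `b`). -/
def Coloring (H K : Subgroup G) : Type u := (H ⧸ K.subgroupOf H) → Bool

/-- `H` acts on functions `H/K → {a, b}` by `(h • f) x = f (h⁻¹ • x)`. -/
instance (H K : Subgroup G) : MulAction H (Coloring H K) := arrowAction

/-- The projection `H/L → H/K` for `L ≤ K`. -/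
def proj (H : Subgroup G) {L K : Subgroup G} (hLK : L ≤ K) :
    (H ⧸ L.subgroupOf H) → (H ⧸ K.subgroupOf H) :=
  Subgroup.quotientMapOfLE (Subgroup.comap_mono hLK)

theorem proj_smul (H : Subgroup G) {L K : Subgroup G} (hLK : L ≤ K) (h : H)
    (y : H ⧸ L.subgroupOf H) : proj H hLK (h • y) = h • proj H hLK y := by
  induction y using QuotientGroup.induction_on with
  | H y => rfl

/-- The sections of the projection `H/L → H/K` for `L ≤ K`. -/
def Sect (H : Subgroup G) {L K : Subgroup G} (hLK : L ≤ K) : Type u :=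
  {s : (H ⧸ K.subgroupOf H) → (H ⧸ L.subgroupOf H) // ∀ x, proj H hLK (s x) = x}

/-- `H` acts on the sections of `H/L → H/K` by `(h • s) x = h • s (h⁻¹ • x)`. -/
instance (H : Subgroup G) {L K : Subgroup G} (hLK : L ≤ K) : MulAction H (Sect H hLK) where
  smul h s := ⟨fun x => h • s.1 (h⁻¹ • x), fun x => by
    rw [proj_smul, s.2, smul_inv_smul]⟩
  one_smul s := Subtype.ext <| funext fun x => by
    change (1 : H) • s.1 ((1 : H)⁻¹ • x) = s.1 x
    simp only [inv_one, one_smul]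
  mul_smul g h s := Subtype.ext <| funext fun x => by
    change (g * h) • s.1 ((g * h)⁻¹ • x) = g • h • s.1 (h⁻¹ • g⁻¹ • x)
    simp only [mul_smul, mul_inv_rev]

end TambaraReciprocity

open TambaraReciprocity in
/-- A `G`-Tambara functor, for a finite group `G`. The value at `H` is the ring `T(G/H)`.
The conjugation `c_{g,H} : T(G/H) → T(G/gHg⁻¹)` is written with an arbitrary subgroup `H'` and an
equation `gHg⁻¹ = H'`, so that the axioms need no transport between equal subgroups. All sums and
products `∑ᶠ`, `∏ᶠ` below are over finite sets; they run over orbits or double cosets, with chosen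
representatives `Quotient.out` (the choice does not matter because conjugations commute with the
structure maps and `c_{h,H}` is the identity for `h ∈ H`). -/
structure TambaraFunctor (G : Type u) [Group G] [Finite G] : Type (max u (v + 1)) where
  obj : Subgroup G → Type v
  [commRing : ∀ H, CommRing (obj H)]
  /-- restriction `r^H_K` -/
  res : ∀ {K H : Subgroup G}, K ≤ H → obj H →+* obj K
  /-- transfer `t^H_K` -/
  tr : ∀ {K H : Subgroup G}, K ≤ H → obj K →+ obj H
  /-- norm `N^H_K` -/
  nm : ∀ {K H : Subgroup G}, K ≤ H → obj K →* obj H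
  /-- conjugation `c_{g,H}` -/
  conj : ∀ (g : G) {H H' : Subgroup G}, conjSubgroup g H = H' → obj H ≃+* obj H'
  -- functoriality
  res_self : ∀ {H : Subgroup G} (x : obj H), res (le_refl H) x = x
  tr_self : ∀ {H : Subgroup G} (x : obj H), tr (le_refl H) x = x
  nm_self : ∀ {H : Subgroup G} (x : obj H), nm (le_refl H) x = x
  res_res : ∀ {L K H : Subgroup G} (hLK : L ≤ K) (hKH : K ≤ H) (x : obj H),
    res hLK (res hKH x) = res (hLK.trans hKH) x
  tr_tr : ∀ {L K H : Subgroup G} (hLK : L ≤ K) (hKH : K ≤ H) (x : obj L),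
    tr hKH (tr hLK x) = tr (hLK.trans hKH) x
  nm_nm : ∀ {L K H : Subgroup G} (hLK : L ≤ K) (hKH : K ≤ H) (x : obj L),
    nm hKH (nm hLK x) = nm (hLK.trans hKH) x
  conj_of_mem : ∀ {H : Subgroup G} (h : G), h ∈ H → ∀ (e : conjSubgroup h H = H) (x : obj H),
    conj h e x = x
  conj_conj : ∀ (g h : G) {H H' H'' : Subgroup G} (e : conjSubgroup h H = H')
    (e' : conjSubgroup g H' = H'') (e'' : conjSubgroup (g * h) H = H'') (x : obj H),
    conj g e' (conj h e x) = conj (g * h) e'' x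
  -- compatibility with conjugation
  conj_res : ∀ (g : G) {K H K' H' : Subgroup G} (eK : conjSubgroup g K = K')
    (eH : conjSubgroup g H = H') (hKH : K ≤ H) (hKH' : K' ≤ H') (x : obj H),
    conj g eK (res hKH x) = res hKH' (conj g eH x)
  conj_tr : ∀ (g : G) {K H K' H' : Subgroup G} (eK : conjSubgroup g K = K')
    (eH : conjSubgroup g H = H') (hKH : K ≤ H) (hKH' : K' ≤ H') (x : obj K),
    conj g eH (tr hKH x) = tr hKH' (conj g eK x)
  conj_nm : ∀ (g : G) {K H K' H' : Subgroup G} (eK : conjSubgroup g K = K')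
    (eH : conjSubgroup g H = H') (hKH : K ≤ H) (hKH' : K' ≤ H') (x : obj K),
    conj g eH (nm hKH x) = nm hKH' (conj g eK x)
  /-- additive double coset formula; `γ` runs over `L \ K / H` -/
  res_tr : ∀ {H L K : Subgroup G} (hH : H ≤ K) (hL : L ≤ K) (x : obj H),
    res hL (tr hH x) =
      ∑ᶠ γ : DoubleCoset.Quotient (L.subgroupOf K : Set K) (H.subgroupOf K : Set K),
        tr (inf_le_left : L ⊓ conjSubgroup ((Quotient.out γ : K) : G) H ≤ L)
          (res inf_le_right (conj ((Quotient.out γ : K) : G) rfl x))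
  /-- multiplicative double coset formula; `γ` runs over `L \ K / H` -/
  res_nm : ∀ {H L K : Subgroup G} (hH : H ≤ K) (hL : L ≤ K) (x : obj H),
    res hL (nm hH x) =
      ∏ᶠ γ : DoubleCoset.Quotient (L.subgroupOf K : Set K) (H.subgroupOf K : Set K),
        nm (inf_le_left : L ⊓ conjSubgroup ((Quotient.out γ : K) : G) H ≤ L)
          (res inf_le_right (conj ((Quotient.out γ : K) : G) rfl x))
  /-- Frobenius reciprocity -/
  tr_res_mul : ∀ {K H : Subgroup G} (hKH : K ≤ H) (x : obj H) (y : obj K),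
    tr hKH (res hKH x * y) = x * tr hKH y
  /-- Tambara reciprocity for sums: `N^H_K (a + b)` is the sum, over the `H`-orbits of functions
  `f : H/K → {a, b}` with stabilizer `S ≤ H`, of the transfer from `S` to `H` of the product, over
  the `S`-orbits of cosets `gK ∈ H/K`, of the norm to `S` of the restriction of `c_g (f (gK))`
  to `S ∩ gKg⁻¹`. -/
  nm_add : ∀ {K H : Subgroup G} (hKH : K ≤ H) (a b : obj K),
    nm hKH (a + b) =
      ∑ᶠ q : MulAction.orbitRel.Quotient H (Coloring H K),
        let f : Coloring H K := Quotient.out q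
        let S : Subgroup H := MulAction.stabilizer H f
        tr (Subgroup.map_subtype_le S)
          (∏ᶠ o : MulAction.orbitRel.Quotient S (H ⧸ K.subgroupOf H),
            let x : H ⧸ K.subgroupOf H := Quotient.out o
            let g : G := ((Quotient.out x : H) : G)
            nm (inf_le_left : S.map H.subtype ⊓ conjSubgroup g K ≤ S.map H.subtype)
              (res inf_le_right (conj g rfl (bif f x then a else b))))
  /-- Tambara reciprocity for transfers: `N^H_K (t^K_L a)` is the sum, over the `H`-orbits of
  sections `s` of `H/L → H/K` with stabilizer `S ≤ H`, of the transfer from `S` to `H` of the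
  product, over the `S`-orbits of `x ∈ H/K`, of the norm to `S` of the restriction of `c_g a` to
  `S ∩ gLg⁻¹`, where `s x = gL`. (The stabilizer of `x` in `S` is `S ∩ gKg⁻¹ = S ∩ gLg⁻¹`.) -/
  nm_tr : ∀ {L K H : Subgroup G} (hLK : L ≤ K) (hKH : K ≤ H) (a : obj L),
    nm hKH (tr hLK a) =
      ∑ᶠ q : MulAction.orbitRel.Quotient H (Sect H hLK),
        let s : Sect H hLK := Quotient.out q
        let S : Subgroup H := MulAction.stabilizer H s
        tr (Subgroup.map_subtype_le S)
          (∏ᶠ o : MulAction.orbitRel.Quotient S (H ⧸ K.subgroupOf H),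
            let x : H ⧸ K.subgroupOf H := Quotient.out o
            let g : G := ((Quotient.out (s.1 x) : H) : G)
            nm (inf_le_left : S.map H.subtype ⊓ conjSubgroup g L ≤ S.map H.subtype)
              (res inf_le_right (conj g rfl a)))

attribute [instance] TambaraFunctor.commRing

/-- A Tambara ideal of `T`; the level at `H` is the ideal `I(G/H)` of `T(G/H)`. -/
@[ext]
structure TambaraIdeal {G : Type u} [Group G] [Finite G] (T : TambaraFunctor.{u, v} G) where
  level : ∀ H : Subgroup G, Ideal (T.obj H)
  res_mem : ∀ {K H : Subgroup G} (hKH : K ≤ H) {x : T.obj H}, x ∈ level H → T.res hKH x ∈ level K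
  tr_mem : ∀ {K H : Subgroup G} (hKH : K ≤ H) {x : T.obj K}, x ∈ level K → T.tr hKH x ∈ level H
  nm_mem : ∀ {K H : Subgroup G} (hKH : K ≤ H) {x : T.obj K}, x ∈ level K → T.nm hKH x ∈ level H
  conj_image : ∀ (g : G) {H H' : Subgroup G} (e : conjSubgroup g H = H'),
    T.conj g e '' (level H : Set (T.obj H)) = (level H' : Set (T.obj H'))

namespace TambaraIdeal

variable {G : Type u} [Group G] [Finite G] {T : TambaraFunctor.{u, v} G}

/-- Tambara ideals are ordered by levelwise inclusion. -/
instance : PartialOrder (TambaraIdeal T) :=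
  PartialOrder.lift TambaraIdeal.level fun _ _ h => TambaraIdeal.ext h

theorem le_iff {I J : TambaraIdeal T} : I ≤ J ↔ ∀ H, I.level H ≤ J.level H := Iff.rfl

/-- The levelwise intersection of a set of Tambara ideals. -/
def inter (A : Set (TambaraIdeal T)) : TambaraIdeal T where
  level H := ⨅ I ∈ A, I.level H
  res_mem hKH x hx := by
    simp only [Submodule.mem_iInf] at hx ⊢
    exact fun I hI => I.res_mem hKH (hx I hI)
  tr_mem hKH x hx := by
    simp only [Submodule.mem_iInf] at hx ⊢
    exact fun I hI => I.tr_mem hKH (hx I hI)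
  nm_mem hKH x hx := by
    simp only [Submodule.mem_iInf] at hx ⊢
    exact fun I hI => I.nm_mem hKH (hx I hI)
  conj_image g H H' e := by
    ext y
    simp only [Set.mem_image, SetLike.mem_coe, Submodule.mem_iInf]
    constructor
    · rintro ⟨x, hx, rfl⟩ I hI
      have := I.conj_image g e
      exact this.subset (Set.mem_image_of_mem _ (hx I hI))
    · intro hy
      refine ⟨(T.conj g e).symm y, fun I hI => ?_, (T.conj g e).apply_symm_apply y⟩
      have h : y ∈ (I.level H' : Set (T.obj H')) := hy I hI
      rw [← I.conj_image g e] at h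
      obtain ⟨x, hx, rfl⟩ := h
      simpa using hx

/-- The Tambara ideal generated by a collection of elements at each level: the intersection of all
Tambara ideals containing it. -/
def span (X : ∀ H : Subgroup G, Set (T.obj H)) : TambaraIdeal T :=
  inter {I | ∀ H, X H ⊆ I.level H}

/-- The Tambara ideal `⟨x⟩` generated by one element `x ∈ T(G/H)`. -/
def principal {H : Subgroup G} (x : T.obj H) : TambaraIdeal T :=
  inter {I | x ∈ I.level H}

/-- The product `I J`: the Tambara ideal generated by the levelwise products of ideals. -/
def mul (I J : TambaraIdeal T) : TambaraIdeal T :=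
  span fun H => (I.level H * J.level H : Ideal (T.obj H))

/-- `I.powSucc n` is the `(n + 1)`-fold product of `I` with itself. -/
def powSucc (I : TambaraIdeal T) : ℕ → TambaraIdeal T
  | 0 => I
  | n + 1 => (I.powSucc n).mul I

/-- The level at `H` of the radical `√I`: the `x ∈ T(G/H)` such that `⟨x⟩ⁿ ⊆ I` for some
`n ≥ 1`. -/
def radicalLevel (I : TambaraIdeal T) (H : Subgroup G) : Set (T.obj H) :=
  {x | ∃ n : ℕ, (principal x).powSucc n ≤ I}

/-- `I = √I`. -/
def IsRadical (I : TambaraIdeal T) : Prop :=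
  ∀ H, (I.level H : Set (T.obj H)) = I.radicalLevel H

end TambaraIdeal

/-- The radical Tambara ideals of `T`. -/
def RadId {G : Type u} [Group G] [Finite G] (T : TambaraFunctor.{u, v} G) : Type (max u v) :=
  {I : TambaraIdeal T // I.IsRadical}

/-- Radical Tambara ideals are ordered by (levelwise) inclusion. -/
instance RadId.instPartialOrder {G : Type u} [Group G] [Finite G] (T : TambaraFunctor.{u, v} G) :
    PartialOrder (RadId T) :=
  inferInstanceAs (PartialOrder {I : TambaraIdeal T // I.IsRadical})

/-! The crux is `TambaraIdeal.radicalLevel_eq`: the levels of `√I` are the ordinary radicals of the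
levels of `I`. Meets, joins and distributivity then reduce to commutative algebra in each ring, the
last being `Ideal.inf_radical_iSup_eq`.

Suppose `x ^ k` lies in `I(G/H)`. At each level the elements `N (r (c_g x))` are finite in number,
and their `k`-th powers lie in `I` because norms, restrictions and conjugations are multiplicative.
The ideal they span therefore has a power inside `I`, and one exponent serves the finitely many
subgroups. By the double coset formulas and reciprocity for transfers, the transfers of multiples of
these elements span a Tambara ideal, which contains `⟨x⟩`. Frobenius reciprocity moves products
inside transfers, so a power of `⟨x⟩` lies in `I`.

Norms are not additive, so closure of a levelwise span under norms (`TambaraIdeal.ofSpan`) needs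
reciprocity for sums and induction on the target subgroup. It also needs `N 0 = 0`, which is not an
axiom (`TambaraFunctor.nm_zero`). -/

theorem dvd_finprod {ι R : Type*} [Finite ι] [CommMonoid R] (f : ι → R) (i : ι) :
    f i ∣ ∏ᶠ j, f j := by
  have := Fintype.ofFinite ι
  rw [finprod_eq_prod_of_fintype]
  exact Finset.dvd_prod_of_mem f (Finset.mem_univ i)

theorem IsIdempotentElem.finprod_const {ι R : Type*} [Finite ι] [Nonempty ι] [CommMonoid R]
    {e : R} (he : IsIdempotentElem e) : ∏ᶠ _ : ι, e = e := by
  have := Fintype.ofFinite ι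
  rw [finprod_eq_prod_of_fintype, Finset.prod_const, Finset.card_univ,
    ← Nat.succ_pred_eq_of_pos (Fintype.card_pos (α := ι)), Nat.succ_eq_add_one,
    he.pow_succ_eq]

theorem AddSubmonoid.finsum_mem {ι M : Type*} [AddCommMonoid M] (S : AddSubmonoid M)
    {f : ι → M} (hf : ∀ i, f i ∈ S) : ∑ᶠ i, f i ∈ S :=
  finsum_induction (· ∈ S) S.zero_mem (fun _ _ => S.add_mem) hf

section Conjugation

variable {G : Type u} [Group G]

theorem mem_conjSubgroup {g x : G} {H : Subgroup G} :
    x ∈ conjSubgroup g H ↔ g⁻¹ * x * g ∈ H := by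
  constructor
  · rintro ⟨y, hy, rfl⟩
    simpa [mul_assoc] using hy
  · exact fun h => ⟨g⁻¹ * x * g, h, by simp [mul_assoc]⟩

theorem conjSubgroup_one (H : Subgroup G) : conjSubgroup 1 H = H := by
  ext; simp [mem_conjSubgroup]

theorem conjSubgroup_conjSubgroup (g h : G) (H : Subgroup G) :
    conjSubgroup g (conjSubgroup h H) = conjSubgroup (g * h) H := by
  ext x
  simp [mem_conjSubgroup, mul_assoc]

theorem conjSubgroup_mono (g : G) {K H : Subgroup G} (h : K ≤ H) :
    conjSubgroup g K ≤ conjSubgroup g H :=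
  Subgroup.map_mono h

theorem conjSubgroup_of_mem {H : Subgroup G} {g : G} (hg : g ∈ H) : conjSubgroup g H = H := by
  ext x
  rw [mem_conjSubgroup, Subgroup.mul_mem_cancel_right _ hg,
    Subgroup.mul_mem_cancel_left _ (inv_mem hg)]

end Conjugation

/-! ### Orbits of colorings -/

namespace TambaraReciprocity

variable {G : Type u} [Group G]

section Finite

variable [Finite G]

instance (H K : Subgroup G) (S : Subgroup H) :
    Finite (MulAction.orbitRel.Quotient S (H ⧸ K.subgroupOf H)) :=
  Quotient.finite _

instance (H K L : Subgroup G) :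
    Finite (DoubleCoset.Quotient (L.subgroupOf H : Set H) (K.subgroupOf H : Set H)) :=
  Quotient.finite _

end Finite

instance (H K : Subgroup G) (S : Subgroup H) :
    Nonempty (MulAction.orbitRel.Quotient S (H ⧸ K.subgroupOf H)) :=
  ⟨Quotient.mk _ ((1 : H) : H ⧸ K.subgroupOf H)⟩

instance (H K L : Subgroup G) :
    Nonempty (DoubleCoset.Quotient (L.subgroupOf H : Set H) (K.subgroupOf H : Set H)) :=
  ⟨Quotient.mk _ 1⟩

/-- The constant coloring. -/
def constColoring (H K : Subgroup G) (c : Bool) : Coloring H K := fun _ => c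

theorem smul_constColoring {H K : Subgroup G} (h : H) (c : Bool) :
    h • constColoring H K c = constColoring H K c := rfl

/-- `H` acts transitively on `H/K`. This isolates the terms of the sum formula whose transfer is the
identity, the only ones out of reach of induction on `H`. -/
theorem eq_constColoring_of_stabilizer_eq_top {H K : Subgroup G} {f : Coloring H K}
    (hf : MulAction.stabilizer H f = ⊤) : ∃ c, f = constColoring H K c := by
  refine ⟨f ((1 : H) : H ⧸ K.subgroupOf H), funext fun x => ?_⟩
  induction x using QuotientGroup.induction_on with
  | H h =>
    have hm : h⁻¹ ∈ MulAction.stabilizer H f := hf ▸ Subgroup.mem_top _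
    have h0 : h⁻¹ • f = f := MulAction.mem_stabilizer_iff.1 hm
    have h1 : f ((h⁻¹)⁻¹ • ((1 : H) : H ⧸ K.subgroupOf H)) = f ((1 : H) : H ⧸ K.subgroupOf H) :=
      congrFun h0 ((1 : H) : H ⧸ K.subgroupOf H)
    rw [inv_inv, MulAction.Quotient.smul_coe, smul_eq_mul, mul_one] at h1
    exact h1

/-- The orbit of a constant coloring. -/
def constOrbit (H K : Subgroup G) (c : Bool) : MulAction.orbitRel.Quotient H (Coloring H K) :=
  Quotient.mk _ (constColoring H K c)

theorem out_constOrbit (H K : Subgroup G) (c : Bool) :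
    (Quotient.out (constOrbit H K c) : Coloring H K) = constColoring H K c := by
  have h : MulAction.orbitRel H (Coloring H K) (Quotient.out (constOrbit H K c))
      (constColoring H K c) :=
    Quotient.mk_out (s := MulAction.orbitRel H (Coloring H K)) _
  obtain ⟨h, hh⟩ := MulAction.orbitRel_apply.1 h
  exact hh.symm

theorem stabilizer_out_eq_top_iff {H K : Subgroup G}
    (q : MulAction.orbitRel.Quotient H (Coloring H K)) :
    MulAction.stabilizer H (Quotient.out q : Coloring H K) = ⊤ ↔
      q = constOrbit H K true ∨ q = constOrbit H K false := by
  constructor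
  · intro h
    obtain ⟨c, hc⟩ := eq_constColoring_of_stabilizer_eq_top h
    have hq : q = constOrbit H K c :=
      (Quotient.out_eq q).symm.trans (congrArg (Quotient.mk _) hc)
    cases c
    · exact Or.inr hq
    · exact Or.inl hq
  · have key : ∀ c,
        MulAction.stabilizer H (Quotient.out (constOrbit H K c) : Coloring H K) = ⊤ := by
      intro c
      rw [out_constOrbit, eq_top_iff]
      exact fun h _ => MulAction.mem_stabilizer_iff.2 (smul_constColoring h c)
    rintro (rfl | rfl) <;> exact key _

theorem constOrbit_ne (H K : Subgroup G) : constOrbit H K true ≠ constOrbit H K false := by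
  intro h
  have h1 : constColoring H K true = constColoring H K false := by
    rw [← out_constOrbit H K true, h, out_constOrbit]
  exact Bool.noConfusion (congrFun h1 ((1 : H) : H ⧸ K.subgroupOf H))

theorem map_subtype_eq_self_iff {H : Subgroup G} {S : Subgroup H} :
    S.map H.subtype = H ↔ S = ⊤ := by
  constructor
  · intro h
    refine Subgroup.map_injective H.subtype_injective ?_
    rw [h, ← MonoidHom.range_eq_map, Subgroup.range_subtype]
  · rintro rfl
    rw [← MonoidHom.range_eq_map, Subgroup.range_subtype]

end TambaraReciprocity

/-! ### The norm of zero and norms of sums -/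

namespace TambaraFunctor

open TambaraReciprocity

variable {G : Type u} [Group G] [Finite G] (T : TambaraFunctor.{u, v} G)

theorem nm_res_conj {K H M : Subgroup G} (hKH : K ≤ H) {g : G} (hg : g ∈ H)
    (hM : M ≤ H) (hM' : M ≤ conjSubgroup g K) (e : conjSubgroup g K ≤ M) (a : T.obj K) :
    T.nm hM (T.res hM' (T.conj g rfl a)) = T.nm hKH a := by
  obtain rfl := le_antisymm hM' e
  rw [T.res_self, ← T.conj_nm g rfl (conjSubgroup_of_mem hg) hKH hM, T.conj_of_mem g hg]

/-- When the stabilizer is all of `H`, the intersection is `gKg⁻¹` itself, and conjugation by `g ∈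
H` is trivial at level `H`. -/
theorem nm_inf_conj {K H S : Subgroup G} (hKH : K ≤ H) {g : G} (hg : g ∈ H) (hS : S = H)
    (a : T.obj K) :
    T.nm (inf_le_left : S ⊓ conjSubgroup g K ≤ S) (T.res inf_le_right (T.conj g rfl a)) =
      T.nm (hKH.trans hS.ge) a := by
  subst hS
  refine T.nm_res_conj hKH hg _ _ (le_inf ?_ le_rfl) a
  exact (conjSubgroup_mono g hKH).trans (conjSubgroup_of_mem hg).le

-- `N 0` is idempotent since `0 * 0 = 0`, so the number of orbits does not matter as long as it is
-- positive. Over a proper stabilizer, `ih` gives a zero factor.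
open Classical in
theorem tr_finprod_nm_zero {K H M : Subgroup G} (hKH : K ≤ H) (hM : M ≤ H)
    (ih : ∀ S < H, ∀ {K : Subgroup G} (hK : K ≤ S), T.nm hK 0 = 0)
    {ι : Type*} [Finite ι] [Nonempty ι] (g : ι → H) :
    T.tr hM (∏ᶠ i, T.nm (inf_le_left : M ⊓ conjSubgroup (g i : G) K ≤ M) 0) =
      if M = H then T.nm hKH 0 else 0 := by
  split_ifs with h
  · subst h
    have h1 (i : ι) : T.nm (inf_le_left : M ⊓ conjSubgroup (g i : G) K ≤ M) 0 = T.nm hKH 0 := by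
      simpa using T.nm_inf_conj hKH (g i).2 rfl 0
    have idem : IsIdempotentElem (T.nm hKH 0) := by
      rw [IsIdempotentElem, ← map_mul, mul_zero]
    simp only [h1, idem.finprod_const, T.tr_self]
  · obtain ⟨i⟩ := ‹Nonempty ι›
    have h1 := dvd_finprod (fun i => T.nm (inf_le_left : M ⊓ conjSubgroup (g i : G) K ≤ M) 0) i
    rw [ih M (lt_of_le_of_ne hM h), zero_dvd_iff] at h1
    rw [h1, map_zero]

/-- Expanding `N (0 + 0)` leaves only the two constant colorings, each contributing `N 0`; hence `N
0 = N 0 + N 0`. -/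
theorem nm_zero {K H : Subgroup G} (hKH : K ≤ H) : T.nm hKH 0 = 0 := by
  classical
  induction H using WellFoundedLT.induction generalizing K with
  | ind H ih =>
    have h := T.nm_add hKH 0 0
    simp only [Bool.cond_self, map_zero, T.tr_finprod_nm_zero hKH _ ih, map_subtype_eq_self_iff,
      stabilizer_out_eq_top_iff] at h
    rw [add_zero, finsum_eq_sum_of_support_subset
      (s := {constOrbit H K true, constOrbit H K false}), Finset.sum_pair (constOrbit_ne H K)] at h
    · simpa using h
    · intro q hq
      by_contra hne
      exact hq (if_neg (by simpa using hne))

end TambaraFunctor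

namespace TambaraFunctor

open TambaraReciprocity

variable {G : Type u} [Group G] [Finite G] (T : TambaraFunctor.{u, v} G)

theorem conj_image_eq {Z : ∀ H : Subgroup G, Set (T.obj H)}
    (hconj : ∀ (g : G) {H H' : Subgroup G} (e : conjSubgroup g H = H') {x : T.obj H},
      x ∈ Z H → T.conj g e x ∈ Z H')
    (g : G) {H H' : Subgroup G} (e : conjSubgroup g H = H') : T.conj g e '' Z H = Z H' := by
  refine Set.Subset.antisymm (Set.image_subset_iff.2 fun x hx => hconj g e hx) fun y hy => ?_
  have e' : conjSubgroup g⁻¹ H' = H := by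
    rw [← e, conjSubgroup_conjSubgroup, inv_mul_cancel, conjSubgroup_one]
  have hg : g * g⁻¹ ∈ H' := by rw [mul_inv_cancel]; exact one_mem H'
  refine ⟨T.conj g⁻¹ e' y, hconj g⁻¹ e' hy, ?_⟩
  rw [T.conj_conj g g⁻¹ e' e (conjSubgroup_of_mem hg), T.conj_of_mem _ hg]

theorem tr_mul {K H : Subgroup G} (hKH : K ≤ H) (y : T.obj K) (x : T.obj H) :
    x * T.tr hKH y = T.tr hKH (T.res hKH x * y) :=
  (T.tr_res_mul hKH x y).symm

/-- The value of the norm on a sum stays in a family of ideals closed under restrictions,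
transfers and conjugations, if the norms of the summands do and if norms to proper subgroups
preserve the family. -/
theorem nm_add_mem {C : ∀ H : Subgroup G, Ideal (T.obj H)}
    (hres : ∀ {K H : Subgroup G} (hKH : K ≤ H) {x : T.obj H}, x ∈ C H → T.res hKH x ∈ C K)
    (htr : ∀ {K H : Subgroup G} (hKH : K ≤ H) {x : T.obj K}, x ∈ C K → T.tr hKH x ∈ C H)
    (hconj : ∀ (g : G) {H H' : Subgroup G} (e : conjSubgroup g H = H') {x : T.obj H},
      x ∈ C H → T.conj g e x ∈ C H')
    {K H : Subgroup G} (hKH : K ≤ H)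
    (ih : ∀ S < H, ∀ {K : Subgroup G} (hK : K ≤ S) {x : T.obj K}, x ∈ C K → T.nm hK x ∈ C S)
    {a b : T.obj K} (ha : a ∈ C K) (hb : b ∈ C K)
    (ha' : T.nm hKH a ∈ C H) (hb' : T.nm hKH b ∈ C H) : T.nm hKH (a + b) ∈ C H := by
  rw [T.nm_add]
  refine (C H).toAddSubmonoid.finsum_mem fun q => htr _ ?_
  have key : ∀ (M : Subgroup G) (_ : M ≤ H) (g : H) (c : T.obj K), c ∈ C K → T.nm hKH c ∈ C H →
      T.nm (inf_le_left : M ⊓ conjSubgroup (g : G) K ≤ M)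
        (T.res inf_le_right (T.conj (g : G) rfl c)) ∈ C M := by
    intro M hM g c hc hc'
    by_cases h : M = H
    · subst h
      rwa [T.nm_inf_conj hKH g.2 rfl]
    · exact ih M (lt_of_le_of_ne hM h) _ (hres _ (hconj _ _ hc))
  -- One factor in the ideal suffices, so any orbit will do.
  obtain ⟨o⟩ : Nonempty (MulAction.orbitRel.Quotient
    (MulAction.stabilizer H (Quotient.out q : Coloring H K)) (H ⧸ K.subgroupOf H)) := inferInstance
  refine Ideal.mem_of_dvd _ (dvd_finprod _ o) (key _ (Subgroup.map_subtype_le _) _ _ ?_ ?_)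
  · cases (Quotient.out q : Coloring H K) (Quotient.out o) <;> assumption
  · cases (Quotient.out q : Coloring H K) (Quotient.out o) <;> assumption

end TambaraFunctor

/-! ### Tambara ideals spanned levelwise, and sums -/

namespace TambaraIdeal

variable {G : Type u} [Group G] [Finite G] {T : TambaraFunctor.{u, v} G}

theorem conj_mem (I : TambaraIdeal T) (g : G) {H H' : Subgroup G} (e : conjSubgroup g H = H')
    {x : T.obj H} (hx : x ∈ I.level H) : T.conj g e x ∈ I.level H' :=
  (I.conj_image g e).subset (Set.mem_image_of_mem _ hx)

/-- A family of ideals spanned by sets is a Tambara ideal if the spanning sets are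
compatible with restrictions, transfers, norms and conjugations. -/
def ofSpan (Z : ∀ H : Subgroup G, Set (T.obj H))
    (hres : ∀ {K H : Subgroup G} (hKH : K ≤ H) {x : T.obj H},
      x ∈ Z H → T.res hKH x ∈ Ideal.span (Z K))
    (htr : ∀ {K H : Subgroup G} (hKH : K ≤ H) (c : T.obj K) {x : T.obj K},
      x ∈ Z K → T.tr hKH (c * x) ∈ Ideal.span (Z H))
    (hnm : ∀ {K H : Subgroup G} (hKH : K ≤ H) {x : T.obj K},
      x ∈ Z K → T.nm hKH x ∈ Ideal.span (Z H))
    (hconj : ∀ (g : G) {H H' : Subgroup G} (e : conjSubgroup g H = H') {x : T.obj H},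
      x ∈ Z H → T.conj g e x ∈ Ideal.span (Z H')) : TambaraIdeal T :=
  have hres' {K H : Subgroup G} (hKH : K ≤ H) {x : T.obj H} (hx : x ∈ Ideal.span (Z H)) :
      T.res hKH x ∈ Ideal.span (Z K) :=
    (Ideal.span_le (I := (Ideal.span (Z K)).comap (T.res hKH))).2 (fun _ => hres hKH) hx
  have htr' {K H : Subgroup G} (hKH : K ≤ H) {x : T.obj K} (hx : x ∈ Ideal.span (Z K)) :
      T.tr hKH x ∈ Ideal.span (Z H) := by
    induction hx using Submodule.closure_induction with
    | zero => rw [map_zero]; exact zero_mem _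
    | add x y _ _ hx hy => rw [map_add]; exact add_mem hx hy
    -- The transfer is not linear over the ring, so multiples of generators must be treated
    -- directly; this is why `htr` carries the coefficient `c`.
    | smul_mem c x hx => exact htr hKH c hx
  have hconj' (g : G) {H H' : Subgroup G} (e : conjSubgroup g H = H') {x : T.obj H}
      (hx : x ∈ Ideal.span (Z H)) : T.conj g e x ∈ Ideal.span (Z H') :=
    (Ideal.span_le (I := (Ideal.span (Z H')).comap (T.conj g e))).2 (fun _ => hconj g e) hx
  { level := fun H => Ideal.span (Z H)
    res_mem := hres'
    tr_mem := htr'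
    nm_mem := by
      intro K H hKH x hx
      -- The sum formula brings in norms from other subgroups into proper subgroups of `H`, hence
      -- the outer induction on `H` with `K` free; the inner one is on the span.
      induction H using WellFoundedLT.induction generalizing K with
      | ind H ih =>
        induction hx using Submodule.closure_induction with
        | zero => rw [T.nm_zero]; exact zero_mem _
        | add x y hx hy hx' hy' =>
          exact T.nm_add_mem hres' htr' hconj' hKH (fun S hS _ hK _ hx => ih S hS hK hx)
            hx hy hx' hy'
        | smul_mem c x hx =>
          rw [smul_eq_mul, map_mul]
          exact Ideal.mul_mem_left _ _ (hnm hKH hx)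
    conj_image := T.conj_image_eq hconj' }

/-- The levelwise sum of a family of Tambara ideals. -/
def sum {ι : Type*} (I : ι → TambaraIdeal T) : TambaraIdeal T :=
  ofSpan (fun H => ⋃ i, ((I i).level H : Set (T.obj H)))
    (fun hKH _ hx => by
      obtain ⟨i, hi⟩ := Set.mem_iUnion.1 hx
      exact Ideal.subset_span (Set.mem_iUnion.2 ⟨i, (I i).res_mem hKH hi⟩))
    (fun hKH c _ hx => by
      obtain ⟨i, hi⟩ := Set.mem_iUnion.1 hx
      exact Ideal.subset_span (Set.mem_iUnion.2
        ⟨i, (I i).tr_mem hKH (Ideal.mul_mem_left _ c hi)⟩))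
    (fun hKH _ hx => by
      obtain ⟨i, hi⟩ := Set.mem_iUnion.1 hx
      exact Ideal.subset_span (Set.mem_iUnion.2 ⟨i, (I i).nm_mem hKH hi⟩))
    (fun g _ _ e _ hx => by
      obtain ⟨i, hi⟩ := Set.mem_iUnion.1 hx
      exact Ideal.subset_span (Set.mem_iUnion.2 ⟨i, (I i).conj_mem g e hi⟩))

theorem sum_level {ι : Type*} (I : ι → TambaraIdeal T) (H : Subgroup G) :
    (sum I).level H = ⨆ i, (I i).level H :=
  (Submodule.iSup_eq_span _).symm

end TambaraIdeal

/-! ### Multiplicative generators of principal Tambara ideals -/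

/-- A family of subsets of the levels of a Tambara functor that is closed under multiplication by
ring elements, restrictions, norms and conjugations. -/
structure TambaraSemiIdeal {G : Type u} [Group G] [Finite G] (T : TambaraFunctor.{u, v} G) where
  carrier : ∀ H : Subgroup G, Set (T.obj H)
  mul_mem : ∀ {H : Subgroup G} (c : T.obj H) {x : T.obj H}, x ∈ carrier H → c * x ∈ carrier H
  res_mem : ∀ {K H : Subgroup G} (hKH : K ≤ H) {x : T.obj H},
    x ∈ carrier H → T.res hKH x ∈ carrier K
  nm_mem : ∀ {K H : Subgroup G} (hKH : K ≤ H) {x : T.obj K},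
    x ∈ carrier K → T.nm hKH x ∈ carrier H
  conj_mem : ∀ (g : G) {H H' : Subgroup G} (e : conjSubgroup g H = H') {x : T.obj H},
    x ∈ carrier H → T.conj g e x ∈ carrier H'

namespace TambaraSemiIdeal

open TambaraReciprocity TambaraIdeal Pointwise

variable {G : Type u} [Group G] [Finite G] {T : TambaraFunctor.{u, v} G}

theorem mem_of_dvd (D : TambaraSemiIdeal T) {H : Subgroup G} {x y : T.obj H} (h : x ∣ y)
    (hx : x ∈ D.carrier H) : y ∈ D.carrier H := by
  obtain ⟨c, rfl⟩ := h
  rw [mul_comm]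
  exact D.mul_mem c hx

/-- The levelwise products of elements of two semi-ideals. -/
def mul (D E : TambaraSemiIdeal T) : TambaraSemiIdeal T where
  carrier H := D.carrier H * E.carrier H
  mul_mem := by
    rintro H c _ ⟨x, hx, y, hy, rfl⟩
    exact ⟨c * x, D.mul_mem c hx, y, hy, mul_assoc _ _ _⟩
  res_mem := by
    rintro K H hKH _ ⟨x, hx, y, hy, rfl⟩
    exact ⟨_, D.res_mem hKH hx, _, E.res_mem hKH hy, (map_mul _ _ _).symm⟩
  nm_mem := by
    rintro K H hKH _ ⟨x, hx, y, hy, rfl⟩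
    exact ⟨_, D.nm_mem hKH hx, _, E.nm_mem hKH hy, (map_mul _ _ _).symm⟩
  conj_mem := by
    rintro g H H' e _ ⟨x, hx, y, hy, rfl⟩
    exact ⟨_, D.conj_mem g e hx, _, E.conj_mem g e hy, (map_mul _ _ _).symm⟩

/-- `D.powSucc n` consists of the products of `n + 1` elements of `D`. -/
def powSucc (D : TambaraSemiIdeal T) : ℕ → TambaraSemiIdeal T
  | 0 => D
  | n + 1 => (D.powSucc n).mul D

/-- The transfers of elements of a semi-ideal. -/
def transfers (D : TambaraSemiIdeal T) (H : Subgroup G) : Set (T.obj H) :=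
  {x | ∃ (K : Subgroup G) (hKH : K ≤ H), ∃ a ∈ D.carrier K, T.tr hKH a = x}

theorem tr_mem_span (D : TambaraSemiIdeal T) {K H : Subgroup G} (hKH : K ≤ H) {a : T.obj K}
    (ha : a ∈ D.carrier K) : T.tr hKH a ∈ Ideal.span (D.transfers H) :=
  Ideal.subset_span ⟨K, hKH, a, ha, rfl⟩

/-- The Tambara ideal whose levels consist of the sums of transfers of elements of `D`. -/
def toIdeal (D : TambaraSemiIdeal T) : TambaraIdeal T :=
  ofSpan D.transfers
    (by
      rintro K H hKH _ ⟨L, hL, a, ha, rfl⟩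
      rw [T.res_tr]
      exact (Ideal.span _).toAddSubmonoid.finsum_mem fun γ =>
        D.tr_mem_span _ (D.res_mem _ (D.conj_mem _ _ ha)))
    (by
      rintro K H hKH c _ ⟨L, hL, a, ha, rfl⟩
      rw [T.tr_mul, T.tr_tr]
      exact D.tr_mem_span _ (D.mul_mem _ ha))
    (by
      rintro K H hKH _ ⟨L, hL, a, ha, rfl⟩
      -- Reciprocity makes the norm of a transfer a sum of transfers of products, each having a
      -- factor in `D`.
      rw [T.nm_tr]
      refine (Ideal.span _).toAddSubmonoid.finsum_mem fun q => D.tr_mem_span _ ?_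
      obtain ⟨o⟩ : Nonempty (MulAction.orbitRel.Quotient
        (MulAction.stabilizer H (Quotient.out q : Sect H hL)) (H ⧸ K.subgroupOf H)) :=
        inferInstance
      exact D.mem_of_dvd (dvd_finprod _ o) (D.nm_mem _ (D.res_mem _ (D.conj_mem _ _ ha))))
    (by
      rintro g H H' e _ ⟨L, hL, a, ha, rfl⟩
      rw [T.conj_tr g rfl e hL (e ▸ conjSubgroup_mono g hL)]
      exact D.tr_mem_span _ (D.conj_mem _ _ ha))

theorem toIdeal_level (D : TambaraSemiIdeal T) (H : Subgroup G) :
    D.toIdeal.level H = Ideal.span (D.transfers H) := rfl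

theorem mem_toIdeal (D : TambaraSemiIdeal T) {H : Subgroup G} {x : T.obj H}
    (hx : x ∈ D.carrier H) : x ∈ D.toIdeal.level H := by
  rw [← T.tr_self x]
  exact D.tr_mem_span le_rfl hx

theorem toIdeal_le {D : TambaraSemiIdeal T} {I : TambaraIdeal T}
    (h : ∀ H, D.carrier H ⊆ I.level H) : D.toIdeal ≤ I := by
  refine le_iff.2 fun H => Ideal.span_le.2 ?_
  rintro _ ⟨K, hK, a, ha, rfl⟩
  exact I.tr_mem hK (h K ha)

theorem mul_mem_toIdeal {D E : TambaraSemiIdeal T} {H : Subgroup G} {a b : T.obj H}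
    (ha : a ∈ D.carrier H) (hb : b ∈ E.toIdeal.level H) :
    a * b ∈ (D.mul E).toIdeal.level H := by
  rw [toIdeal_level] at hb
  induction hb using Submodule.span_induction with
  | mem x hx =>
    obtain ⟨K, hK, e, he, rfl⟩ := hx
    rw [T.tr_mul]
    exact tr_mem_span _ hK ⟨_, D.res_mem hK ha, e, he, rfl⟩
  | zero => rw [mul_zero]; exact zero_mem _
  | add x y _ _ hx hy => rw [mul_add]; exact add_mem hx hy
  | smul c x _ hx =>
    rw [smul_eq_mul, mul_left_comm]
    exact Ideal.mul_mem_left _ _ hx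

/-- Frobenius reciprocity, used twice: `tr d * y = tr (d * res y)` reduces to a left factor in `D`,
and `mul_mem_toIdeal` treats the right factor likewise. -/
theorem toIdeal_mul_le (D E : TambaraSemiIdeal T) (H : Subgroup G) :
    D.toIdeal.level H * E.toIdeal.level H ≤ (D.mul E).toIdeal.level H := by
  refine Ideal.mul_le.2 fun x hx y hy => ?_
  rw [toIdeal_level] at hx
  induction hx using Submodule.span_induction with
  | mem x hx =>
    obtain ⟨K, hK, d, hd, rfl⟩ := hx
    rw [mul_comm, T.tr_mul, mul_comm]
    exact TambaraIdeal.tr_mem _ hK (mul_mem_toIdeal hd (E.toIdeal.res_mem hK hy))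
  | zero => rw [zero_mul]; exact zero_mem _
  | add x z _ _ hx hz => rw [add_mul]; exact add_mem hx hz
  | smul c x _ hx =>
    rw [smul_eq_mul, mul_assoc]
    exact Ideal.mul_mem_left _ _ hx

/-- The multiples of the elements `N^K_M (res (c_g x))`. -/
def principal {H : Subgroup G} (x : T.obj H) : TambaraSemiIdeal T where
  carrier K := {y | ∃ (g : G) (M : Subgroup G) (hM : M ≤ K) (hM' : M ≤ conjSubgroup g H),
    T.nm hM (T.res hM' (T.conj g rfl x)) ∣ y}
  mul_mem := by
    rintro K c y ⟨g, M, hM, hM', h⟩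
    exact ⟨g, M, hM, hM', h.mul_left c⟩
  nm_mem := by
    rintro L K hLK y ⟨g, M, hM, hM', h⟩
    refine ⟨g, M, hM.trans hLK, hM', ?_⟩
    rw [← T.nm_nm hM hLK]
    exact map_dvd (T.nm hLK) h
  conj_mem := by
    rintro k K K' e y ⟨g, M, hM, hM', h⟩
    refine ⟨k * g, conjSubgroup k M, e ▸ conjSubgroup_mono k hM,
      (conjSubgroup_mono k hM').trans (conjSubgroup_conjSubgroup k g H).le, ?_⟩
    rw [← T.conj_conj k g rfl (conjSubgroup_conjSubgroup k g H) rfl,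
      ← T.conj_res k rfl (conjSubgroup_conjSubgroup k g H) hM',
      ← T.conj_nm k rfl e hM]
    exact map_dvd (T.conj k e) h
  res_mem := by
    rintro L K hLK y ⟨g, M, hM, hM', h⟩
    -- Every factor of the double coset product divides the restriction, so any `γ` works; its
    -- factor is a generator again, with conjugating element `γ * g`.
    obtain ⟨γ⟩ : Nonempty (DoubleCoset.Quotient (L.subgroupOf K : Set K)
      (M.subgroupOf K : Set K)) := inferInstance
    have h1 := map_dvd (T.res hLK) h
    rw [T.res_nm] at h1
    refine ⟨((Quotient.out γ : K) : G) * g, L ⊓ conjSubgroup ((Quotient.out γ : K) : G) M,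
      inf_le_left, inf_le_right.trans ((conjSubgroup_mono _ hM').trans
        (conjSubgroup_conjSubgroup _ g H).le), ((dvd_of_eq ?_).trans (dvd_finprod _ γ)).trans h1⟩
    rw [← T.conj_conj _ g rfl (conjSubgroup_conjSubgroup _ g H) rfl,
      T.conj_res _ rfl (conjSubgroup_conjSubgroup _ g H) hM' ((conjSubgroup_mono _ hM').trans
        (conjSubgroup_conjSubgroup _ g H).le), T.res_res]

theorem mem_principal {H : Subgroup G} (x : T.obj H) : x ∈ (principal x).carrier H := by
  refine ⟨1, H, le_rfl, (conjSubgroup_one H).ge, dvd_of_eq ?_⟩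
  rw [T.nm_self, ← T.conj_res 1 (conjSubgroup_one H) rfl le_rfl, T.res_self,
    T.conj_of_mem 1 (one_mem H)]

/-- A finitely generated ideal containing a level of `principal x`. -/
def principalSpan {H : Subgroup G} (x : T.obj H) (K : Subgroup G) : Ideal (T.obj K) :=
  Ideal.span (Set.range fun p : {p : G × Subgroup G // p.2 ≤ K ∧ p.2 ≤ conjSubgroup p.1 H} =>
    T.nm p.2.1 (T.res p.2.2 (T.conj p.1.1 rfl x)))

theorem principal_powSucc_subset {H : Subgroup G} (x : T.obj H) (n : ℕ) (K : Subgroup G) :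
    ((principal x).powSucc n).carrier K ⊆ (principalSpan x K ^ (n + 1) : Ideal (T.obj K)) := by
  have h1 : (principal x).carrier K ⊆ principalSpan x K := by
    rintro y ⟨g, M, hM, hM', h⟩
    exact Ideal.mem_of_dvd _ h (Ideal.subset_span ⟨⟨(g, M), hM, hM'⟩, rfl⟩)
  induction n with
  | zero => simpa [powSucc] using h1
  | succ n ih =>
    rintro _ ⟨a, ha, b, hb, rfl⟩
    rw [pow_succ]
    exact Ideal.mul_mem_mul (ih ha) (h1 hb)

/-- The exponent that works for `x` works for each generator, powers commuting with norms,
restrictions and conjugations. -/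
theorem principalSpan_le_radical {I : TambaraIdeal T} {H : Subgroup G} {x : T.obj H}
    (hx : x ∈ (I.level H).radical) (K : Subgroup G) :
    principalSpan x K ≤ (I.level K).radical := by
  obtain ⟨n, hn⟩ := hx
  refine Ideal.span_le.2 ?_
  rintro _ ⟨⟨⟨g, M⟩, hM, hM'⟩, rfl⟩
  refine ⟨n, ?_⟩
  simp only [← map_pow]
  exact I.nm_mem _ (I.res_mem _ (I.conj_mem _ _ hn))

end TambaraSemiIdeal

/-! ### Levels of the radical -/

namespace TambaraIdeal

variable {G : Type u} [Group G] [Finite G] {T : TambaraFunctor.{u, v} G}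

theorem principal_le_iff {H : Subgroup G} {x : T.obj H} {I : TambaraIdeal T} :
    principal x ≤ I ↔ x ∈ I.level H := by
  constructor
  · refine fun h => h H ?_
    simp only [principal, inter, Submodule.mem_iInf]
    exact fun J hJ => hJ
  · exact fun hx K => iInf₂_le I hx

theorem mem_principal {H : Subgroup G} (x : T.obj H) : x ∈ (principal x).level H :=
  principal_le_iff.1 le_rfl

theorem mul_le_iff {I J L : TambaraIdeal T} :
    I.mul J ≤ L ↔ ∀ H, I.level H * J.level H ≤ L.level H := by
  constructor
  · refine fun h H => le_trans (fun x hx => ?_) (h H)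
    simp only [mul, span, inter, Submodule.mem_iInf]
    exact fun L hL => hL H hx
  · exact fun h H => iInf₂_le L h

theorem level_mul_le (I J : TambaraIdeal T) (H : Subgroup G) :
    I.level H * J.level H ≤ (I.mul J).level H :=
  mul_le_iff.1 le_rfl H

theorem powSucc_mono {I J : TambaraIdeal T} (h : I ≤ J) (n : ℕ) : I.powSucc n ≤ J.powSucc n := by
  induction n with
  | zero => exact h
  | succ n ih =>
    exact mul_le_iff.2 fun H => (Ideal.mul_mono (ih H) (h H)).trans (level_mul_le _ _ H)

theorem pow_mem_powSucc {I : TambaraIdeal T} {H : Subgroup G} {x : T.obj H} (hx : x ∈ I.level H)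
    (n : ℕ) : x ^ (n + 1) ∈ (I.powSucc n).level H := by
  induction n with
  | zero => simpa [powSucc] using hx
  | succ n ih =>
    rw [pow_succ]
    exact level_mul_le _ _ H (Ideal.mul_mem_mul ih hx)

theorem principal_le_toIdeal {H : Subgroup G} (x : T.obj H) :
    principal x ≤ (TambaraSemiIdeal.principal x).toIdeal :=
  principal_le_iff.2 (TambaraSemiIdeal.mem_toIdeal _ (TambaraSemiIdeal.mem_principal x))

theorem toIdeal_powSucc_le (D : TambaraSemiIdeal T) (n : ℕ) :
    D.toIdeal.powSucc n ≤ (D.powSucc n).toIdeal := by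
  induction n with
  | zero => exact le_rfl
  | succ n ih =>
    exact mul_le_iff.2 fun H => (Ideal.mul_mono_left (ih H)).trans
      (TambaraSemiIdeal.toIdeal_mul_le _ _ H)

/-- The levels of the radical of a Tambara ideal are the radicals of its levels. -/
theorem radicalLevel_eq (I : TambaraIdeal T) (H : Subgroup G) :
    I.radicalLevel H = (I.level H).radical := by
  ext x
  constructor
  · rintro ⟨n, hn⟩
    exact ⟨n + 1, hn H (pow_mem_powSucc (mem_principal x) n)⟩
  · intro hx
    have hfg (K : Subgroup G) : (TambaraSemiIdeal.principalSpan x K).FG :=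
      Submodule.fg_span (Set.finite_range _)
    choose m hm using fun K : Subgroup G => Ideal.exists_pow_le_of_le_radical_of_fg
      (TambaraSemiIdeal.principalSpan_le_radical hx K) (hfg K)
    -- `G` has finitely many subgroups, so the exponents `m K` have a common bound. Since `powSucc
    -- n` is an `(n + 1)`-fold product, this bound is more than enough.
    obtain ⟨n, hn⟩ := (Set.finite_range m).bddAbove
    refine ⟨n, (powSucc_mono (principal_le_toIdeal x) n).trans ((toIdeal_powSucc_le _ n).trans
      (TambaraSemiIdeal.toIdeal_le fun K => ?_))⟩
    refine (TambaraSemiIdeal.principal_powSucc_subset x n K).trans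
      ((Ideal.pow_le_pow_right ?_).trans (hm K))
    exact (hn ⟨K, rfl⟩).trans n.le_succ

theorem isRadical_iff {I : TambaraIdeal T} : I.IsRadical ↔ ∀ H, (I.level H).IsRadical := by
  simp only [IsRadical, radicalLevel_eq, SetLike.coe_set_eq, ← Ideal.radical_eq_iff, eq_comm]

/-- The radical of a Tambara ideal. -/
def radical (I : TambaraIdeal T) : TambaraIdeal T :=
  have hconj (g : G) {H H' : Subgroup G} (e : conjSubgroup g H = H') {x : T.obj H}
      (hx : x ∈ (I.level H).radical) : T.conj g e x ∈ (I.level H').radical := by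
    obtain ⟨n, hn⟩ := hx
    exact ⟨n, by rw [← map_pow]; exact I.conj_mem g e hn⟩
  { level := fun H => (I.level H).radical
    res_mem := by
      rintro K H hKH x ⟨n, hn⟩
      exact ⟨n, by rw [← map_pow]; exact I.res_mem hKH hn⟩
    nm_mem := by
      rintro K H hKH x ⟨n, hn⟩
      exact ⟨n, by rw [← map_pow]; exact I.nm_mem hKH hn⟩
    tr_mem := by
      intro K H hKH x hx
      -- Transfers do not commute with powers; the description by products of ideals helps instead,
      -- because `⟨tr x⟩ ≤ ⟨x⟩`.
      rw [← SetLike.mem_coe, ← radicalLevel_eq] at hx ⊢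
      obtain ⟨n, hn⟩ := hx
      exact ⟨n, (powSucc_mono (principal_le_iff.2
        ((principal x).tr_mem hKH (mem_principal x))) n).trans hn⟩
    conj_image := T.conj_image_eq hconj }

theorem isRadical_radical (I : TambaraIdeal T) : I.radical.IsRadical :=
  isRadical_iff.2 fun H => Ideal.radical_isRadical (I.level H)

theorem inter_level (A : Set (TambaraIdeal T)) (H : Subgroup G) :
    (inter A).level H = ⨅ I ∈ A, I.level H := rfl

end TambaraIdeal

/-! ### The frame of radical Tambara ideals -/

theorem Ideal.inf_radical_iSup_eq {R : Type*} [CommRing R] {ι : Sort*} {K : Ideal R}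
    (hK : K.IsRadical) (I : ι → Ideal R) :
    K ⊓ (⨆ i, I i).radical = (⨆ i, K ⊓ I i).radical := by
  refine le_antisymm ?_ (le_inf ?_ ?_)
  · rintro x ⟨hx, n, hn⟩
    refine ⟨n + 1, ?_⟩
    -- The extra factor `x ∈ K` puts the power in a product of ideals, which distributes over sums
    -- although intersection does not.
    have h : x ^ (n + 1) ∈ K * ⨆ i, I i := by
      rw [pow_succ']
      exact Ideal.mul_mem_mul hx hn
    rw [Ideal.mul_iSup] at h
    exact iSup_mono (fun i => Ideal.mul_le_inf) h
  · exact hK.radical_le_iff.2 (iSup_le fun i => inf_le_left)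
  · exact Ideal.radical_mono (iSup_mono fun i => inf_le_right)

namespace RadId

open TambaraIdeal

variable {G : Type u} [Group G] [Finite G] {T : TambaraFunctor.{u, v} G}

theorem le_iff {I J : RadId T} : I ≤ J ↔ ∀ H, I.1.level H ≤ J.1.level H := Iff.rfl

theorem level_isRadical (I : RadId T) (H : Subgroup G) : (I.1.level H).IsRadical :=
  isRadical_iff.1 I.2 H

/-- The radical of the levelwise sum. -/
def join {ι : Type*} (I : ι → RadId T) : RadId T :=
  ⟨(sum fun i => (I i).1).radical, isRadical_radical _⟩

theorem join_level {ι : Type*} (I : ι → RadId T) (H : Subgroup G) :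
    (join I).1.level H = (⨆ i, (I i).1.level H).radical := by
  rw [← sum_level]; rfl

theorem isLUB_join {ι : Type*} (I : ι → RadId T) : IsLUB (Set.range I) (join I) := by
  constructor
  · rintro _ ⟨i, rfl⟩
    refine le_iff.2 fun H => ?_
    rw [join_level]
    exact (le_iSup (fun i => (I i).1.level H) i).trans Ideal.le_radical
  · intro J hJ
    refine le_iff.2 fun H => ?_
    rw [join_level, (J.level_isRadical H).radical_le_iff]
    exact iSup_le fun i => le_iff.1 (hJ ⟨i, rfl⟩) H

/-- The levelwise intersection. -/
def meet {ι : Type*} (I : ι → RadId T) : RadId T :=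
  ⟨inter (Set.range fun i => (I i).1), isRadical_iff.2 fun H => by
    rw [inter_level, iInf_range]
    exact Ideal.isRadical_iInf _ fun i => (I i).level_isRadical H⟩

theorem meet_level {ι : Type*} (I : ι → RadId T) (H : Subgroup G) :
    (meet I).1.level H = ⨅ i, (I i).1.level H := by
  change (inter _).level H = _
  rw [inter_level, iInf_range]

theorem isGLB_meet {ι : Type*} (I : ι → RadId T) : IsGLB (Set.range I) (meet I) := by
  constructor
  · rintro _ ⟨i, rfl⟩
    refine le_iff.2 fun H => ?_
    rw [meet_level]
    exact iInf_le _ i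
  · intro J hJ
    refine le_iff.2 fun H => ?_
    rw [meet_level]
    exact le_iInf fun i => le_iff.1 (hJ ⟨i, rfl⟩) H

/-- The complete lattice of radical Tambara ideals. -/
abbrev completeLattice (T : TambaraFunctor.{u, v} G) : CompleteLattice (RadId T) :=
  letI : InfSet (RadId T) := ⟨fun A => meet fun I : A => I.1⟩
  completeLatticeOfInf (RadId T) fun A => by
    have h := isGLB_meet fun I : A => I.1
    rwa [Subtype.range_coe] at h

section Frame

attribute [local instance] completeLattice

theorem iInf_level {ι : Type*} (I : ι → RadId T) (H : Subgroup G) :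
    (⨅ i, I i).1.level H = ⨅ i, (I i).1.level H := by
  rw [← (isGLB_meet I).unique isGLB_iInf, meet_level]

theorem iSup_eq_join {ι : Type*} (I : ι → RadId T) : ⨆ i, I i = join I :=
  isLUB_iSup.unique (isLUB_join I)

theorem inf_level (I J : RadId T) (H : Subgroup G) :
    (I ⊓ J).1.level H = I.1.level H ⊓ J.1.level H := by
  rw [inf_eq_iInf, iInf_level, inf_eq_iInf]
  exact iInf_congr fun b => by cases b <;> rfl

variable (T) in
/-- The frame of radical Tambara ideals. -/
abbrev frame : Order.Frame (RadId T) :=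
  Order.Frame.ofMinimalAxioms
    { inf_sSup_le_iSup_inf := fun K A => by
        rw [sSup_eq_iSup', ← iSup_subtype'', iSup_eq_join, iSup_eq_join]
        refine le_iff.2 fun H => ?_
        rw [inf_level, join_level, join_level, Ideal.inf_radical_iSup_eq (K.level_isRadical H)]
        simp only [inf_level, le_refl] }

end Frame

end RadId

theorem mainTheorem6 {G : Type u} [Group G] [Finite G] (T : TambaraFunctor.{u, v} G) :
    ∃ F : Order.Frame (RadId T),
      -- the order of the frame is inclusion
      F.toPartialOrder = RadId.instPartialOrder T ∧
      -- meets are levelwise intersections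
      (∀ (I J : RadId T) (H : Subgroup G), (I ⊓ J).1.level H = I.1.level H ⊓ J.1.level H) ∧
      (∀ (ι : Type w) (I : ι → RadId T) (H : Subgroup G),
        (⨅ i, I i).1.level H = ⨅ i, (I i).1.level H) ∧
      -- levelwise sums are Tambara ideals, and joins are their radicals
      (∀ (ι : Type w) (I : ι → RadId T), ∃ J : TambaraIdeal T,
        (∀ H, J.level H = ⨆ i, (I i).1.level H) ∧
        (∀ H, ((⨆ i, I i).1.level H : Set (T.obj H)) = J.radicalLevel H)) ∧
      -- at each level the join is the radical of the sum in the ring, and the frame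
      -- distributivity law is the corresponding identity between ideals of the ring
      (∀ (ι : Type w) (I : ι → RadId T) (H : Subgroup G),
        (⨆ i, I i).1.level H = (⨆ i, (I i).1.level H).radical) ∧
      (∀ (ι : Type w) (K : RadId T) (I : ι → RadId T) (H : Subgroup G),
        K.1.level H ⊓ (⨆ i, (I i).1.level H).radical =
          (⨆ i, K.1.level H ⊓ (I i).1.level H).radical) := by
  refine ⟨RadId.frame T, rfl, RadId.inf_level, fun ι I H => RadId.iInf_level I H,
    fun ι I => ⟨TambaraIdeal.sum fun i => (I i).1, TambaraIdeal.sum_level _, fun H => ?_⟩,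
    fun ι I H => ?_, fun ι K I H => Ideal.inf_radical_iSup_eq (K.level_isRadical H) _⟩
  · rw [TambaraIdeal.radicalLevel_eq]
    exact congrArg (fun J : RadId T => (J.1.level H : Set (T.obj H))) (RadId.iSup_eq_join I)
  · rw [← RadId.join_level]
    exact congrArg (fun J : RadId T => J.1.level H) (RadId.iSup_eq_join I)
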